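/- Let $\mathcal X$ be an infinite-dimensional separable real Hilbert space. Derivatives $D$ are Fréchet derivatives; the derivative of a real function is identified with an element of $\mathcal X$ by the Riesz theorem (so $D^2f(x)\in L(\mathcal X)$), and $D_1,D_2$ are partial derivatives in the first and second variable. Let $C$ be a self-adjoint, nonnegative, trace class operator on $\mathcal X$, with an orthonormal basis $(e_i)_{i\ge1}$ of $\mathcal X$ such that $Ce_i=\lambda_ie_i$, and let $N_C$ be the centred Gaussian measure with covariance operator $C$. Let $U:\mathcal X\to\mathbb R$ be Borel measurable, let $P\propto e^{-U}N_C$ and $Q$ be Borel probability measures on $\mathcal X$, and suppose that $DU$ exists $N_C$-almost everywhere and $Q$-almost everywhere, that $$\mathbb E_Q\|X\|^2<\infty,\qquad \mathbb E_Q\|CDU(X)\|<\infty,\qquad \mathbb E_{N_C}\|C^{1/2}DU(X)\|^2<\infty,$$ and that $e^{-U/2}\in W^{1,2}_C(\mathcal X)$, the domain of the closure in $L^2(N_C)$ of the Malliavin derivative $C^{1/2}D$ on smooth cylindrical functions. Write $b(x)=x+CDU(x)$. Let $k:\mathcal X\times\mathcal X\to\mathbb R$ be a symmetric positive definite kernel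 with RKHS $\mathcal H_k$, and let $\mathcal H_K$ be the RKHS of $\mathcal X$-valued functions with kernel $K(x,y)=k(x,y)I_{\mathcal X}$. For $f\in\mathcal H_k$ and $F\in\mathcal H_K$ put $$\mathcal Af(x)=\mathrm{Tr}[CD^2f(x)]-\langle Df(x),b(x)\rangle,\qquad \mathcal A_vF(x)=\mathrm{Tr}[CDF(x)]-\langle F(x),b(x)\rangle,$$ $$\mathrm{KSD}_{\mathcal A,k}(Q,P)=\sup_{\|f\|_{k}\le1}|\mathbb E_Q[\mathcal Af(X)]|,\qquad \mathrm{KSD}_{\mathcal A_v,K}(Q,P)=\sup_{\|F\|_{K}\le1}|\mathbb E_Q[\mathcal A_vF(X)]|.$$ For $\alpha\in\mathbb N$, $k\in C_b^{(\alpha,\alpha)}$ means that the derivatives $D_1^iD_2^jk$, $0\le i,j\le\alpha$, exist and are continuous and bounded on $\mathcal X\times\mathcal X$. In $D_2^nD_1^mk(x,x')[\dots]$ and $D_1^nD_2^mk(x,x')[\dots]$ the $m$ directions of the inner derivative are listed first. (i) If $k\in C_b^{(2,2)}$, then $\mathrm{KSD}_{\mathcal A,k}(Q,P)$ is well defined and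 finite (every $f\in\mathcal H_k$ is twice Fréchet differentiable, $CD^2f(x)$ is trace class for every $x$, and $\mathcal Af$ is $Q$-integrable), and $$\mathrm{KSD}_{\mathcal A,k}(Q,P)^2=\mathbb E_{(X,X')\sim Q\times Q}[h(X,X')],$$ where $$\begin{aligned}h(x,x')={}&\sum_{i,j=1}^\infty\lambda_i\lambda_jD_2^2D_1^2k(x,x')[e_i,e_i,e_j,e_j]-\sum_{i=1}^\infty\lambda_iD_2^2D_1k(x,x')[b(x),e_i,e_i]\\&-\sum_{i=1}^\infty\lambda_iD_1^2D_2k(x,x')[b(x'),e_i,e_i]+D_2D_1k(x,x')[b(x),b(x')],\end{aligned}$$ the series converging absolutely and $h$ being $Q\times Q$-integrable. (ii) If $k\in C_b^{(1,1)}$, then $\mathrm{KSD}_{\mathcal A_v,K}(Q,P)$ is well defined and finite (every $F\in\mathcal H_K$ is Fréchet differentiable, $CDF(x)$ is trace class for every $x$, and $\mathcal A_vF$ is $Q$-integrable), and $$\mathrm{KSD}_{\mathcal A_v,K}(Q,P)^2=\mathbb E_{(X,X')\sim Q\times Q}[h_v(X,X')],$$ where $$\begin{aligned}h_v(x,x')={}&\mathrm{Tr}[C^2D_2D_1k(x,x')]-\langle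 D_1k(x,x'),Cx'+C^2DU(x')\rangle\\&-\langle D_2k(x,x'),Cx+C^2DU(x)\rangle+k(x,x')\langle x+CDU(x),x'+CDU(x')\rangle,\end{aligned}$$ the operator $C^2D_2D_1k(x,x')$ being trace class for all $x,x'$ and $h_v$ being $Q\times Q$-integrable. -/

import Mathlib

open MeasureTheory ProbabilityTheory Filter Topology
open scoped RealInnerProductSpace ContDiff

noncomputable section

namespace SteinKernel

variable {E : Type*} [NormedAddCommGroup E] [InnerProductSpace ℝ E] [CompleteSpace E]

/-! ### Trace class operators -/

/-- Nuclear (trace class) operators on a Hilbert space: `A y = ∑ ⟪a n, y⟫ b n` with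
`∑ ‖a n‖ ‖b n‖ < ∞`. -/
def IsTraceClass (A : E →L[ℝ] E) : Prop :=
  ∃ a b : ℕ → E, Summable (fun n => ‖a n‖ * ‖b n‖) ∧
    ∀ y, HasSum (fun n => ⟪a n, y⟫ • b n) (A y)

/-- The trace `∑ ⟪v, A v⟫`, the sum running over an orthonormal basis; for a trace class operator
the series converges absolutely and its value does not depend on the basis. -/
def trace (A : E →L[ℝ] E) : ℝ :=
  ∑' v : (exists_hilbertBasis ℝ E).choose, ⟪(v : E), A v⟫

/-! ### Gaussian measures and the Malliavin-Sobolev space -/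

/-- `γ` is the centred Gaussian measure `N_C`: each `⟪y, ·⟫` has law `N(0, ⟪C y, y⟫)`. -/
def IsCenteredGaussian [MeasurableSpace E] (C : E →L[ℝ] E) (γ : Measure E) : Prop :=
  IsProbabilityMeasure γ ∧
    ∀ y : E, γ.map (fun x => ⟪y, x⟫) = gaussianReal 0 (Real.toNNReal ⟪C y, y⟫)

/-- `R = C^{1/2}`, the nonnegative square root of `C`. -/
def IsSqrt (R C : E →L[ℝ] E) : Prop := R.IsPositive ∧ R ∘L R = C

/-- Smooth cylindrical functions `x ↦ φ (⟪l₁, x⟫, …, ⟪lₙ, x⟫)` with `φ` smooth, bounded with all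
its derivatives. -/
def IsSmoothCylindrical (f : E → ℝ) : Prop :=
  ∃ (n : ℕ) (l : Fin n → E) (φ : EuclideanSpace ℝ (Fin n) → ℝ),
    ContDiff ℝ ∞ φ ∧ (∀ m : ℕ, ∃ M : ℝ, ∀ t, ‖iteratedFDeriv ℝ m φ t‖ ≤ M) ∧
    f = fun x => φ (WithLp.toLp 2 (fun i => ⟪l i, x⟫))

/-- `f ∈ W^{1,2}_C`, the domain of the closure in `L²(γ)`, `γ = N_C`, of the Malliavin derivative
`R D = C^{1/2} D`, defined initially on smooth cylindrical functions. -/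
def MemMalliavinSobolev [MeasurableSpace E] [BorelSpace E] (R : E →L[ℝ] E) (γ : Measure E)
    (f : E → ℝ) : Prop :=
  MemLp f 2 γ ∧ ∃ G : E → E, MemLp G 2 γ ∧ ∃ φ : ℕ → E → ℝ,
    (∀ n, IsSmoothCylindrical (φ n)) ∧
    Tendsto (fun n => eLpNorm (fun x => φ n x - f x) 2 γ) atTop (𝓝 0) ∧
    Tendsto (fun n => eLpNorm (fun x => R (gradient (φ n) x) - G x) 2 γ) atTop (𝓝 0)

/-- The standing assumptions on the target `P ∝ exp(-U) N_C` (with `γ = N_C`, `R = C^{1/2}`) and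
on the candidate `Q`. The derivative `DU` is the Fréchet derivative, seen as an element of the
space; it has to exist almost everywhere for `N_C` and for `Q`. -/
structure GibbsAssumption [MeasurableSpace E] [BorelSpace E] (C R : E →L[ℝ] E) (U : E → ℝ)
    (γ P Q : Measure E) : Prop where
  pos : C.IsPositive
  traceClass : IsTraceClass C
  sqrt : IsSqrt R C
  gaussian : IsCenteredGaussian C γ
  measurable_U : Measurable U
  differentiable_gaussian : ∀ᵐ x ∂γ, DifferentiableAt ℝ U x
  differentiable_Q : ∀ᵐ x ∂Q, DifferentiableAt ℝ U x
  isProb_P : IsProbabilityMeasure P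
  isProb_Q : IsProbabilityMeasure Q
  gibbs : ∃ Z : ℝ, 0 < Z ∧
    P = γ.withDensity (fun x => ENNReal.ofReal (Real.exp (-U x) / Z))
  integrable_sq_norm : Integrable (fun x => ‖x‖ ^ 2) Q
  integrable_drift : Integrable (fun x => ‖C (gradient U x)‖) Q
  sobolev : MemMalliavinSobolev R γ (fun x => Real.exp (-U x / 2))
  integrable_malliavin : Integrable (fun x => ‖R (gradient U x)‖ ^ 2) γ

/-! ### Kernels and partial derivatives -/

/-- Symmetric positive definite real kernels. -/
def IsKernel (k : E → E → ℝ) : Prop :=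
  (∀ x y, k x y = k y x) ∧
    ∀ (n : ℕ) (x : Fin n → E) (c : Fin n → ℝ), 0 ≤ ∑ i, ∑ j, c i * c j * k (x i) (x j)

/-- `D₁^m D₂^n F (x, y)`. -/
def D12 (m n : ℕ) (F : E → E → ℝ) (x y : E) :
    ContinuousMultilinearMap ℝ (fun _ : Fin m => E)
      (ContinuousMultilinearMap ℝ (fun _ : Fin n => E) ℝ) :=
  iteratedFDeriv ℝ m (fun z => iteratedFDeriv ℝ n (fun w => F z w) y) x

/-- `D₂^n D₁^m F (x, y)`. -/
def D21 (n m : ℕ) (F : E → E → ℝ) (x y : E) :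
    ContinuousMultilinearMap ℝ (fun _ : Fin n => E)
      (ContinuousMultilinearMap ℝ (fun _ : Fin m => E) ℝ) :=
  iteratedFDeriv ℝ n (fun w => iteratedFDeriv ℝ m (fun z => F z w) x) y

/-- `F ∈ C_b^{(α,α)}`: the derivatives `D₁^i D₂^j F`, `i, j ≤ α`, exist, are jointly continuous and
bounded. The first two fields express existence. -/
structure IsCb (α : ℕ) (F : E → E → ℝ) : Prop where
  contDiff_snd : ∀ x, ContDiff ℝ α (fun w => F x w)
  contDiff_fst : ∀ j ≤ α, ∀ y, ContDiff ℝ α (fun z => iteratedFDeriv ℝ j (fun w => F z w) y)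
  continuous : ∀ i ≤ α, ∀ j ≤ α, Continuous (fun p : E × E => D12 i j F p.1 p.2)
  bounded : ∀ i ≤ α, ∀ j ≤ α, ∃ M : ℝ, ∀ x y, ‖D12 i j F x y‖ ≤ M

/-! ### Stein operators and kernel Stein discrepancies -/

/-- The drift `x + C DU(x)`. -/
def drift (C : E →L[ℝ] E) (U : E → ℝ) (x : E) : E := x + C (gradient U x)

/-- The Stein operator `Tr[C D²f(x)] - ⟪Df(x), x + C DU(x)⟫`; here `D²f(x)` is the bounded operator
that is the derivative of the gradient. -/
def steinOp (C : E →L[ℝ] E) (U : E → ℝ) (f : E → ℝ) (x : E) : ℝ :=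
  trace (C ∘L fderiv ℝ (gradient f) x) - ⟪gradient f x, drift C U x⟫

/-- The vectorised Stein operator `Tr[C DF(x)] - ⟪F(x), x + C DU(x)⟫`. -/
def steinOpVec (C : E →L[ℝ] E) (U : E → ℝ) (F : E → E) (x : E) : ℝ :=
  trace (C ∘L fderiv ℝ F x) - ⟪F x, drift C U x⟫

/-- The values `|E_Q[𝒜 f]|`, for `f` in the unit ball of the scalar RKHS `H`. -/
def ksdValues [MeasurableSpace E] (H : Type*) [NormedAddCommGroup H] [InnerProductSpace ℝ H]
    [RKHS ℝ H E ℝ] (C : E →L[ℝ] E) (U : E → ℝ) (Q : Measure E) : Set ℝ :=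
  {r | ∃ f : H, ‖f‖ ≤ 1 ∧ r = |∫ x, steinOp C U (⇑f) x ∂Q|}

/-- The kernel Stein discrepancy of `Q` from `P ∝ exp(-U) N_C`. -/
def ksd [MeasurableSpace E] (H : Type*) [NormedAddCommGroup H] [InnerProductSpace ℝ H]
    [RKHS ℝ H E ℝ] (C : E →L[ℝ] E) (U : E → ℝ) (Q : Measure E) : ℝ :=
  sSup (ksdValues H C U Q)

/-- The values `|E_Q[𝒜ᵥ F]|`, for `F` in the unit ball of the vector valued RKHS `H`. -/
def ksdVecValues [MeasurableSpace E] (H : Type*) [NormedAddCommGroup H] [InnerProductSpace ℝ H]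
    [RKHS ℝ H E E] (C : E →L[ℝ] E) (U : E → ℝ) (Q : Measure E) : Set ℝ :=
  {r | ∃ F : H, ‖F‖ ≤ 1 ∧ r = |∫ x, steinOpVec C U (⇑F) x ∂Q|}

/-- The vectorised kernel Stein discrepancy of `Q` from `P ∝ exp(-U) N_C`. -/
def ksdVec [MeasurableSpace E] (H : Type*) [NormedAddCommGroup H] [InnerProductSpace ℝ H]
    [RKHS ℝ H E E] (C : E →L[ℝ] E) (U : E → ℝ) (Q : Measure E) : ℝ :=
  sSup (ksdVecValues H C U Q)

/-! ### The Stein kernels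

In `D₂^n D₁^m k(x, x')[u₁, …, uₘ, v₁, …, vₙ]` the directions `u` of the inner derivative `D₁^m` come
first, those of the outer one last; in `D21 n m k x x' v u` the outer ones come first. -/

/-- `λᵢ λⱼ D₂² D₁² k(x, x')[eᵢ, eᵢ, eⱼ, eⱼ]`. -/
def term22 (e : ℕ → E) (lam : ℕ → ℝ) (k : E → E → ℝ) (x x' : E) (p : ℕ × ℕ) : ℝ :=
  lam p.1 * lam p.2 * D21 2 2 k x x' ![e p.2, e p.2] ![e p.1, e p.1]

/-- `λᵢ D₂² D₁ k(x, x')[x + C DU(x), eᵢ, eᵢ]`. -/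
def term21 (C : E →L[ℝ] E) (U : E → ℝ) (e : ℕ → E) (lam : ℕ → ℝ) (k : E → E → ℝ) (x x' : E)
    (i : ℕ) : ℝ :=
  lam i * D21 2 1 k x x' ![e i, e i] ![drift C U x]

/-- `λᵢ D₁² D₂ k(x, x')[x' + C DU(x'), eᵢ, eᵢ]`. -/
def term12 (C : E →L[ℝ] E) (U : E → ℝ) (e : ℕ → E) (lam : ℕ → ℝ) (k : E → E → ℝ) (x x' : E)
    (i : ℕ) : ℝ :=
  lam i * D12 2 1 k x x' ![e i, e i] ![drift C U x']

/-- The Stein kernel `h`. -/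
def h (C : E →L[ℝ] E) (U : E → ℝ) (e : ℕ → E) (lam : ℕ → ℝ) (k : E → E → ℝ) (x x' : E) : ℝ :=
  (∑' p : ℕ × ℕ, term22 e lam k x x' p)
    - (∑' i, term21 C U e lam k x x' i)
    - (∑' i, term12 C U e lam k x x' i)
    + D21 1 1 k x x' ![drift C U x'] ![drift C U x]

/-- `D₁ k(x, x')` as an element of the space. -/
def grad1 (k : E → E → ℝ) (x x' : E) : E := gradient (fun z => k z x') x

/-- `D₂ k(x, x')` as an element of the space. -/
def grad2 (k : E → E → ℝ) (x x' : E) : E := gradient (fun w => k x w) x'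

/-- `D₂ D₁ k(x, x')` as a bounded operator. -/
def grad21 (k : E → E → ℝ) (x x' : E) : E →L[ℝ] E := fderiv ℝ (fun w => grad1 k x w) x'

/-- The Stein kernel `hᵥ`. -/
def hv (C : E →L[ℝ] E) (U : E → ℝ) (k : E → E → ℝ) (x x' : E) : ℝ :=
  trace (C ∘L C ∘L grad21 k x x')
    - ⟪grad1 k x x', C x' + C (C (gradient U x'))⟫
    - ⟪grad2 k x x', C x + C (C (gradient U x))⟫
    + k x x' * ⟪drift C U x, drift C U x'⟫

end SteinKernel

end

/-! Both Stein operators are pairings with a vector field in the RKHS: `𝒜 f (x) = ⟪ξ x, f⟫` with `ξ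
x = ∑ λᵢ sᵢ(x) - r(x, b(x))`. In the scalar case `sᵢ(x)` represents `f ↦ D²f(x)[eᵢ, eᵢ]` and `r(x,
v)` represents `f ↦ Df(x)[v]`; in the vector case they represent `F ↦ ⟪eᵢ, DF(x) eᵢ⟫` and `F ↦ ⟪v, F
x⟫`. Since `∑ |λᵢ| < ∞` and the representers are bounded uniformly in `x`, the series is bounded and
the other term is `O(‖b(x)‖)`, so `ξ` is Bochner integrable under `Q`. Hence `E_Q[𝒜 f] = ⟪E_Q ξ,
f⟫`, the supremum over the unit ball is `‖E_Q ξ‖`, and its square is the double integral of `⟪ξ x, ξ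
x'⟫` (`discrepancy_of_representer`). Inner products of representers are mixed derivatives of `k`
(`IsDerivRep.inner_eq_D21`), which turns the integrand into the Stein kernel.

The representers exist by Riesz once the elements of the RKHS are known to be `Cⁿ` with `‖Dⁿf(x)‖ ≤
M ‖f‖`. This is proved with finite differences: a difference of `f` is the pairing of `f` with a
difference of kernel sections, whose squared norm is a double difference of `k`, controlled by the
mean value inequality. The resulting bound for smooth elements passes to all of `H` by density
(`contDiff_coe`). Values in a Hilbert space `V` and kernel `k • id` cover both cases at once. -/

namespace SteinKernel

/-! ### Trace class operators and independence of the trace from the basis. -/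

section TraceClass

variable {E : Type*} [NormedAddCommGroup E] [InnerProductSpace ℝ E]

lemma IsTraceClass.comp_right [CompleteSpace E] {C : E →L[ℝ] E} (hC : IsTraceClass C) (A : E →L[ℝ] E) :
    IsTraceClass (C ∘L A) := by
  obtain ⟨a, b, hs, h⟩ := hC
  refine ⟨fun n => ContinuousLinearMap.adjoint A (a n), b, ?_, fun y => ?_⟩
  · refine Summable.of_nonneg_of_le (fun n => by positivity) (fun n => ?_)
      (hs.mul_left ‖ContinuousLinearMap.adjoint A‖)
    rw [← mul_assoc]
    gcongr
    exact ContinuousLinearMap.le_opNorm _ _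
  · simpa [ContinuousLinearMap.adjoint_inner_left] using h (A y)

/-- Parseval's identity, with the summability of the absolute values. -/
lemma summable_abs_inner_mul_inner {ι : Type*} (e : HilbertBasis ι ℝ E) (x y : E) :
    Summable (fun i => |⟪x, e i⟫ * ⟪e i, y⟫|) ∧
      ∑' i, |⟪x, e i⟫ * ⟪e i, y⟫| ≤ ‖x‖ * ‖y‖ := by
  have hfin : ∀ s : Finset ι, ∑ i ∈ s, |⟪x, e i⟫ * ⟪e i, y⟫| ≤ ‖x‖ * ‖y‖ := fun s => by
    refine le_of_sq_le_sq ?_ (by positivity)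
    have hb : ∀ z : E, ∑ i ∈ s, |⟪e i, z⟫| ^ 2 ≤ ‖z‖ ^ 2 := fun z =>
      e.orthonormal.sum_inner_products_le z
    calc (∑ i ∈ s, |⟪x, e i⟫ * ⟪e i, y⟫|) ^ 2
        = (∑ i ∈ s, |⟪e i, x⟫| * |⟪e i, y⟫|) ^ 2 := by
          simp only [abs_mul, real_inner_comm]
      _ ≤ (∑ i ∈ s, |⟪e i, x⟫| ^ 2) * ∑ i ∈ s, |⟪e i, y⟫| ^ 2 :=
          Finset.sum_mul_sq_le_sq_mul_sq _ _ _
      _ ≤ ‖x‖ ^ 2 * ‖y‖ ^ 2 :=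
          mul_le_mul (hb x) (hb y) (Finset.sum_nonneg fun _ _ => by positivity) (by positivity)
      _ = (‖x‖ * ‖y‖) ^ 2 := by ring
  exact ⟨summable_of_sum_le (fun _ => abs_nonneg _) hfin,
    Real.tsum_le_of_sum_le (fun _ => abs_nonneg _) hfin⟩

/-- Interchange of the double series `⟪aₙ, eᵢ⟫ ⟪eᵢ, bₙ⟫`, absolutely summable by Cauchy-Schwarz in
`i`. The value involves only `a` and `b`, so it is the same for every basis. -/
lemma IsTraceClass.hasSum_inner {A : E →L[ℝ] E} {a b : ℕ → E}
    (hs : Summable (fun n => ‖a n‖ * ‖b n‖)) (h : ∀ y, HasSum (fun n => ⟪a n, y⟫ • b n) (A y))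
    {ι : Type*} (e : HilbertBasis ι ℝ E) :
    HasSum (fun i => ⟪e i, A (e i)⟫) (∑' n, ⟪a n, b n⟫) := by
  have hF : Summable (fun p : ℕ × ι => ⟪a p.1, e p.2⟫ * ⟪e p.2, b p.1⟫) := by
    refine Summable.of_norm ?_
    rw [summable_prod_of_nonneg (fun p => norm_nonneg _)]
    refine ⟨fun n => (summable_abs_inner_mul_inner e (a n) (b n)).1, ?_⟩
    exact Summable.of_nonneg_of_le (fun n => tsum_nonneg fun i => norm_nonneg _)
      (fun n => (summable_abs_inner_mul_inner e (a n) (b n)).2) hs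
  have h1 : HasSum (fun p : ℕ × ι => ⟪a p.1, e p.2⟫ * ⟪e p.2, b p.1⟫) (∑' n, ⟪a n, b n⟫) := by
    have := hF.hasSum
    simpa only [hF.tsum_prod, e.tsum_inner_mul_inner] using this
  refine ((Equiv.prodComm ι ℕ).hasSum_iff.mpr h1).prod_fiberwise fun i => ?_
  have := (h (e i)).mapL (innerSL ℝ (e i))
  simpa [inner_smul_right] using this

lemma IsTraceClass.hasSum_trace [CompleteSpace E] {A : E →L[ℝ] E} (hA : IsTraceClass A) {ι : Type*}
    (e : HilbertBasis ι ℝ E) : HasSum (fun i => ⟪e i, A (e i)⟫) (trace A) := by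
  obtain ⟨a, b, hs, h⟩ := hA
  obtain ⟨e', he'⟩ := (exists_hilbertBasis ℝ E).choose_spec
  have h' := IsTraceClass.hasSum_inner hs h e'
  rw [he'] at h'
  rw [trace, h'.tsum_eq]
  exact IsTraceClass.hasSum_inner hs h e

end TraceClass

/-! ### Iterated finite differences versus derivatives. -/

section FiniteDifferences

variable {W : Type*} [NormedAddCommGroup W] [NormedSpace ℝ W]

/-- The iterated finite difference of `G` along a list of increments. -/
def iterDiff {E W : Type*} [Add E] [Sub W] : List E → (E → W) → E → W
  | [], G => G
  | u :: us, G => iterDiff us (fun x => G (x + u) - G x)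

lemma map_iterDiff {E W W' : Type*} [Add E] [AddCommGroup W] [AddCommGroup W'] (L : W →+ W')
    (us : List E) (G : E → W) (x : E) :
    L (iterDiff us G x) = iterDiff us (fun z => L (G z)) x := by
  induction us generalizing G with
  | nil => rfl
  | cons u us ih => simp [iterDiff, ih]

lemma contDiff_iterDiff_param {E : Type*} [Add E] {F : Type*} [NormedAddCommGroup F] [NormedSpace ℝ F] {n : ℕ}
    (us : List E) (G : E → F → W) (hG : ∀ z, ContDiff ℝ n (G z)) (x : E) :
    ContDiff ℝ n (fun w => iterDiff us (fun z => G z w) x) := by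
  induction us generalizing G with
  | nil => exact hG x
  | cons u us ih => exact ih (fun z w => G (z + u) w - G z w) fun z => (hG _).sub (hG _)

lemma iteratedFDeriv_iterDiff_param {E : Type*} [Add E] {F : Type*} [NormedAddCommGroup F] [NormedSpace ℝ F] {n : ℕ}
    (us : List E) (G : E → F → W) (hG : ∀ z, ContDiff ℝ n (G z)) (x : E) (w : F) :
    iteratedFDeriv ℝ n (fun w => iterDiff us (fun z => G z w) x) w =
      iterDiff us (fun z => iteratedFDeriv ℝ n (G z) w) x := by
  induction us generalizing G with
  | nil => rfl
  | cons u us ih =>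
    simp only [iterDiff]
    rw [ih (fun z w => G (z + u) w - G z w) fun z => (hG _).sub (hG _)]
    congr 1
    funext z
    exact iteratedFDeriv_sub_apply (hG _).contDiffAt (hG _).contDiffAt

variable {E : Type*} [NormedAddCommGroup E] [NormedSpace ℝ E]

lemma iteratedFDeriv_translate_sub {n : ℕ} {G : E → W} (hG : ContDiff ℝ n G) (u x : E) :
    iteratedFDeriv ℝ n (fun x => G (x + u) - G x) x =
      iteratedFDeriv ℝ n G (x + u) - iteratedFDeriv ℝ n G x := by
  rw [← iteratedFDeriv_comp_add_right n u x]
  exact iteratedFDeriv_sub_apply (hG.comp (contDiff_id.add contDiff_const)).contDiffAt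
    hG.contDiffAt

lemma ContDiff.translate_sub {n : ℕ} {G : E → W} (hG : ContDiff ℝ n G) (u : E) :
    ContDiff ℝ n (fun x => G (x + u) - G x) :=
  (hG.comp (contDiff_id.add contDiff_const)).sub hG

/-- The mean value inequality for iterated finite differences. -/
lemma norm_iterDiff_le (us : List E) {G : E → W} (hG : ContDiff ℝ us.length G) {M : ℝ}
    (hM : ∀ x, ‖iteratedFDeriv ℝ us.length G x‖ ≤ M) (x : E) :
    ‖iterDiff us G x‖ ≤ M * (us.map norm).prod := by
  induction us generalizing G M with
  | nil => simpa [iterDiff] using hM x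
  | cons u us ih =>
    have hlen : ((us.length : ℕ) : WithTop ℕ∞) ≤ ((u :: us).length : ℕ) := by
      exact_mod_cast Nat.le_succ _
    have hG' := hG.of_le hlen
    rw [List.map_cons, List.prod_cons, ← mul_assoc]
    -- The first difference trades one derivative for a factor `‖u‖`: its derivative of order
    -- `us.length` is bounded by `M * ‖u‖`.
    refine ih (ContDiff.translate_sub hG' u) fun y => ?_
    rw [iteratedFDeriv_translate_sub hG']
    have := Convex.norm_image_sub_le_of_norm_fderiv_le (𝕜 := ℝ) (s := Set.univ) (C := M)
      (f := iteratedFDeriv ℝ us.length G) (x := y) (y := y + u)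
      (fun z _ => (hG.differentiable_iteratedFDeriv
        (by exact_mod_cast Nat.lt_succ_self _)).differentiableAt)
      (fun z _ => by rw [norm_fderiv_iteratedFDeriv]; exact hM z) convex_univ trivial trivial
    simpa using this

/-- Bounds on iterated finite differences bound the derivatives. -/
lemma norm_iteratedFDeriv_le_of_iterDiff {n : ℕ} {G : E → W} (hG : ContDiff ℝ n G) {M : ℝ}
    (hM0 : 0 ≤ M) (hM : ∀ us : List E, us.length = n → ∀ x,
      ‖iterDiff us G x‖ ≤ M * (us.map norm).prod) (x : E) :
    ‖iteratedFDeriv ℝ n G x‖ ≤ M := by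
  induction n generalizing G M x with
  | zero => simpa [iterDiff] using hM [] rfl x
  | succ n ih =>
    have hG' : ContDiff ℝ n G := hG.of_le (by exact_mod_cast Nat.le_succ n)
    rw [← norm_fderiv_iteratedFDeriv]
    refine norm_fderiv_le_of_lip' ℝ hM0 (Eventually.of_forall fun y => ?_)
    -- The increment `y - x` is spent as the first entry of the list, so the bound of order `n` for
    -- this difference is a Lipschitz estimate at `x` for `Dⁿ G`.
    have := ih (G := fun z => G (z + (y - x)) - G z) (M := M * ‖y - x‖)
      (ContDiff.translate_sub hG' _) (by positivity)
      (fun us hus z => by simpa [mul_assoc, iterDiff] using hM ((y - x) :: us) (by simp [hus]) z) x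
    rwa [iteratedFDeriv_translate_sub hG', add_sub_cancel] at this

end FiniteDifferences

/-! ### Consequences of `C_b` regularity and symmetry of the kernel. -/

section Kernel

variable {E : Type*} [NormedAddCommGroup E] [InnerProductSpace ℝ E]

lemma IsCb.mono {α β : ℕ} {k : E → E → ℝ} (hk : IsCb β k) (h : α ≤ β) : IsCb α k where
  contDiff_snd x := (hk.contDiff_snd x).of_le (by exact_mod_cast h)
  contDiff_fst j hj y := (hk.contDiff_fst j (hj.trans h) y).of_le (by exact_mod_cast h)
  continuous i hi j hj := hk.continuous i (hi.trans h) j (hj.trans h)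
  bounded i hi j hj := hk.bounded i (hi.trans h) j (hj.trans h)

/-- `IsCb` differentiates in the second variable before the first; symmetry of `k` supplies the
opposite order. -/
lemma IsCb.contDiff_iteratedFDeriv_fst {α : ℕ} {k : E → E → ℝ} (hk : IsCb α k)
    (hsymm : ∀ x y, k x y = k y x) {j : ℕ} (hj : j ≤ α) (x : E) :
    ContDiff ℝ α (fun w => iteratedFDeriv ℝ j (fun z => k z w) x) := by
  have h : (fun w => iteratedFDeriv ℝ j (fun z => k z w) x) =
      fun w => iteratedFDeriv ℝ j (fun z => k w z) x := by
    funext w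
    congr 1
    funext z
    exact hsymm z w
  exact h ▸ hk.contDiff_fst j hj x

/-- Mean value inequality in each variable in turn. The bound is written as a square because the
left side will be the squared norm of a difference of kernel sections; hence the constant `√M`
below. -/
lemma IsCb.exists_iterDiff_le {α : ℕ} {k : E → E → ℝ} (hk : IsCb α k) :
    ∃ M : ℝ, 0 ≤ M ∧ ∀ us : List E, us.length = α → ∀ x,
      |iterDiff us (fun w => iterDiff us (fun z => k z w) x) x| ≤ (M * (us.map norm).prod) ^ 2 := by
  obtain ⟨M, hM⟩ := hk.bounded α le_rfl α le_rfl
  have hM0 : 0 ≤ M := (norm_nonneg (D12 α α k 0 0)).trans (hM 0 0)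
  refine ⟨√M, Real.sqrt_nonneg _, fun us hus x => ?_⟩
  subst hus
  have h1 : ∀ w, ‖iterDiff us (fun z => iteratedFDeriv ℝ us.length (k z) w) x‖ ≤
      M * (us.map norm).prod := fun w =>
    norm_iterDiff_le us (hk.contDiff_fst _ le_rfl w) (fun z => hM z w) x
  have h2 := norm_iterDiff_le us (G := fun w => iterDiff us (fun z => k z w) x)
    (contDiff_iterDiff_param us k hk.contDiff_snd x)
    (fun w => by
      rw [iteratedFDeriv_iterDiff_param us k hk.contDiff_snd x w]
      exact h1 w) x
  rw [mul_pow, Real.sq_sqrt hM0, sq, ← mul_assoc]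
  exact h2

end Kernel

/-! ### Elements of the RKHS inherit the smoothness of the kernel. -/

section Smoothness

lemma kerFun_apply_eq {X V H : Type*} [NormedAddCommGroup V] [InnerProductSpace ℝ V]
    [CompleteSpace V] [NormedAddCommGroup H] [InnerProductSpace ℝ H] [CompleteSpace H]
    [RKHS ℝ H X V] {k : X → X → ℝ}
    (hH : ∀ x y, RKHS.kernel H x y = k x y • ContinuousLinearMap.id ℝ V)
    (x y : X) (v : V) : RKHS.kerFun H y v x = k x y • v := by
  rw [RKHS.kerFun_apply, hH]; rfl

lemma inner_kerFun_kerFun {X V H : Type*} [NormedAddCommGroup V] [InnerProductSpace ℝ V]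
    [CompleteSpace V] [NormedAddCommGroup H] [InnerProductSpace ℝ H] [CompleteSpace H]
    [RKHS ℝ H X V] {k : X → X → ℝ}
    (hH : ∀ x y, RKHS.kernel H x y = k x y • ContinuousLinearMap.id ℝ V)
    (x y : X) (v w : V) :
    ⟪RKHS.kerFun H x v, RKHS.kerFun H y w⟫ = k x y * ⟪v, w⟫ := by
  rw [RKHS.kerFun_inner, kerFun_apply_eq hH, inner_smul_right]

/-- Differences are additive, so they leave the inner product one slot at a time, and the
reproducing property reduces what remains to `k`. -/
lemma norm_iterDiff_kerFun_sq {X V H : Type*} [Add X] [NormedAddCommGroup V] [InnerProductSpace ℝ V]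
    [CompleteSpace V] [NormedAddCommGroup H] [InnerProductSpace ℝ H] [CompleteSpace H]
    [RKHS ℝ H X V] {k : X → X → ℝ}
    (hH : ∀ x y, RKHS.kernel H x y = k x y • ContinuousLinearMap.id ℝ V)
    (us : List X) (x : X) (v : V) :
    ‖iterDiff us (fun z => RKHS.kerFun H z v) x‖ ^ 2 =
      iterDiff us (fun w => iterDiff us (fun z => k z w) x) x * ‖v‖ ^ 2 := by
  rw [← real_inner_self_eq_norm_sq]
  have h1 : ∀ a, ⟪a, iterDiff us (fun z => RKHS.kerFun H z v) x⟫ =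
      iterDiff us (fun z => ⟪a, RKHS.kerFun H z v⟫) x := fun a =>
    map_iterDiff ((innerSL ℝ a : H →L[ℝ] ℝ) : H →+ ℝ) us _ x
  have h2 : ∀ a, ⟪iterDiff us (fun z => RKHS.kerFun H z v) x, a⟫ =
      iterDiff us (fun z => ⟪RKHS.kerFun H z v, a⟫) x := fun a => by
    rw [real_inner_comm, h1]
    simp only [real_inner_comm]
  have h3 := map_iterDiff (AddMonoidHom.mulRight (‖v‖ ^ 2)) us
    (fun w => iterDiff us (fun z => k z w) x) x
  have h4 : ∀ w, iterDiff us (fun z => k z w * ‖v‖ ^ 2) x =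
      iterDiff us (fun z => k z w) x * ‖v‖ ^ 2 := fun w =>
    (map_iterDiff (AddMonoidHom.mulRight (‖v‖ ^ 2)) us (fun z => k z w) x).symm
  rw [h1]
  simp only [h2, inner_kerFun_kerFun hH, real_inner_self_eq_norm_sq, h4]
  exact h3.symm

variable {E : Type*} [NormedAddCommGroup E] [InnerProductSpace ℝ E]
  {V : Type*} [NormedAddCommGroup V] [InnerProductSpace ℝ V] [CompleteSpace V]
  {H : Type*} [NormedAddCommGroup H] [InnerProductSpace ℝ H] [CompleteSpace H] [RKHS ℝ H E V]
  {k : E → E → ℝ}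

omit [InnerProductSpace ℝ E] in
-- By the reproducing property, pairing a difference of `f` with `v` is pairing `f` with the same
-- difference of kernel sections; Cauchy-Schwarz concludes.
lemma norm_iterDiff_coe_le
    (hH : ∀ x y, RKHS.kernel H x y = k x y • ContinuousLinearMap.id ℝ V)
    {us : List E} {x : E} {M : ℝ} (hM : 0 ≤ M)
    (h : |iterDiff us (fun w => iterDiff us (fun z => k z w) x) x| ≤ M ^ 2) (f : H) :
    ‖iterDiff us (f : E → V) x‖ ≤ M * ‖f‖ := by
  have hv : ∀ v : V, ⟪iterDiff us (f : E → V) x, v⟫ ≤ M * ‖f‖ * ‖v‖ := fun v => by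
    have h1 : ⟪iterDiff us (f : E → V) x, v⟫ =
        ⟪f, iterDiff us (fun z => RKHS.kerFun H z v) x⟫ := by
      have e1 := map_iterDiff ((innerSL ℝ f : H →L[ℝ] ℝ) : H →+ ℝ) us
        (fun z => RKHS.kerFun H z v) x
      have e2 := map_iterDiff ((innerSL ℝ v : V →L[ℝ] ℝ) : V →+ ℝ) us (f : E → V) x
      simp only [AddMonoidHom.coe_coe, innerSL_apply_apply, RKHS.inner_kerFun] at e1 e2
      rw [real_inner_comm, e2, e1]
      simp only [real_inner_comm]
    have h2 : ‖iterDiff us (fun z => RKHS.kerFun H z v) x‖ ≤ M * ‖v‖ := by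
      refine le_of_sq_le_sq ?_ (by positivity)
      rw [norm_iterDiff_kerFun_sq hH, mul_pow]
      exact mul_le_mul_of_nonneg_right ((le_abs_self _).trans h) (by positivity)
    calc ⟪iterDiff us (f : E → V) x, v⟫ ≤ ‖f‖ * (M * ‖v‖) :=
          h1 ▸ (real_inner_le_norm _ _).trans (by gcongr)
      _ = M * ‖f‖ * ‖v‖ := by ring
  -- Testing against the difference itself turns the weak bound into a norm bound.
  have := hv (iterDiff us (f : E → V) x)
  rw [real_inner_self_eq_norm_sq, sq] at this
  by_contra! hlt
  have h0 : 0 < ‖iterDiff us (f : E → V) x‖ := lt_of_le_of_lt (by positivity) hlt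
  exact absurd (le_of_mul_le_mul_right this h0) (not_le.mpr hlt)

/-- Uniform bound on the derivatives of the smooth elements of a reproducing kernel Hilbert
space. -/
lemma exists_norm_iteratedFDeriv_le_of_contDiff
    (hH : ∀ x y, RKHS.kernel H x y = k x y • ContinuousLinearMap.id ℝ V) {n : ℕ}
    (hk : IsCb n k) : ∃ M : ℝ, 0 ≤ M ∧ ∀ f : H, ContDiff ℝ n (f : E → V) → ∀ x,
      ‖iteratedFDeriv ℝ n (f : E → V) x‖ ≤ M * ‖f‖ := by
  obtain ⟨M, hM0, hM⟩ := hk.exists_iterDiff_le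
  refine ⟨M, hM0, fun f hf x => ?_⟩
  refine norm_iteratedFDeriv_le_of_iterDiff hf (by positivity) (fun us hus x => ?_) x
  have hp : 0 ≤ (us.map norm).prod := List.prod_nonneg (by simp)
  have := norm_iterDiff_coe_le hH (by positivity) (hM us hus x) f
  linarith

/-- The elements of a reproducing kernel Hilbert space are as smooth as the kernel. -/
theorem contDiff_coe (hH : ∀ x y, RKHS.kernel H x y = k x y • ContinuousLinearMap.id ℝ V)
    (hsymm : ∀ x y, k x y = k y x) {n : ℕ} (hk : IsCb n k) (f : H) :
    ContDiff ℝ n (f : E → V) := by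
  let S : Submodule ℝ H :=
    { carrier := {g | ContDiff ℝ n (g : E → V)}
      add_mem' := fun {a b} ha hb => by
        simp only [Set.mem_ofPred_eq, RKHS.coe_add] at *
        exact ha.add hb
      zero_mem' := by
        simp only [Set.mem_ofPred_eq, RKHS.coe_zero]
        exact contDiff_const
      smul_mem' := fun c a ha => by
        simp only [Set.mem_ofPred_eq, RKHS.coe_smul] at *
        exact ha.const_smul c }
  have hS : Submodule.span ℝ {RKHS.kerFun H x v | (x) (v)} ≤ S := by
    rw [Submodule.span_le]
    rintro _ ⟨x, v, rfl⟩
    change ContDiff ℝ n (RKHS.kerFun H x v : E → V)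
    have : (RKHS.kerFun H x v : E → V) = fun y => k x y • v := by
      funext y
      rw [kerFun_apply_eq hH, hsymm]
    rw [this]
    exact (hk.contDiff_snd x).smul contDiff_const
  have hf : f ∈ closure (S.toAddSubgroup : Set H) := by
    have : f ∈ (Submodule.span ℝ {RKHS.kerFun H x v | (x) (v)}).topologicalClosure := by
      rw [RKHS.kerFun_dense]; trivial
    exact closure_mono hS this
  -- A series of smooth elements with geometrically decaying norms: by the uniform derivative
  -- bounds, all its derivatives up to order `n` converge uniformly.
  obtain ⟨g, hlim, hg, -, hgn⟩ := controlled_sum_of_mem_closure hf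
    (b := fun n => (1 / 2 : ℝ) ^ n) (fun n => by positivity)
  -- The term of index `0` has no small norm, hence the shift by one.
  have hgs : Summable (fun i => ‖g i‖) := by
    rw [← summable_nat_add_iff 1]
    refine Summable.of_nonneg_of_le (fun _ => norm_nonneg _)
      (fun i => (hgn (i + 1) i.succ_pos).le) ?_
    exact (summable_nat_add_iff 1).mpr summable_geometric_two
  have hsum : HasSum g f := by
    have h1 := hgs.of_norm.hasSum
    have h2 := (h1.tendsto_sum_nat.comp (tendsto_add_atTop_nat 1))
    rwa [tendsto_nhds_unique h2 hlim] at h1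
  have hfun : (f : E → V) = fun x => ∑' i, g i x := by
    funext x
    have := (hsum.mapL ((RKHS.kerFun H x).adjoint)).tsum_eq
    simpa using this.symm
  choose! M hM0 hM using fun (m : ℕ) (hm : m ≤ n) =>
    exists_norm_iteratedFDeriv_le_of_contDiff hH (hk.mono hm)
  rw [hfun]
  refine contDiff_tsum (N := (n : ℕ∞)) (v := fun m i => M m * ‖g i‖) (fun i => hg i)
    (fun m _ => hgs.mul_left _) (fun m i x hm => ?_)
  have hm' : m ≤ n := by exact_mod_cast hm
  have hgi : ContDiff ℝ n (g i : E → V) := hg i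
  exact hM m hm' (g i) (hgi.of_le (by exact_mod_cast hm')) x

theorem exists_norm_iteratedFDeriv_le
    (hH : ∀ x y, RKHS.kernel H x y = k x y • ContinuousLinearMap.id ℝ V)
    (hsymm : ∀ x y, k x y = k y x) {n : ℕ} (hk : IsCb n k) : ∃ M : ℝ, 0 ≤ M ∧ ∀ (f : H) x,
      ‖iteratedFDeriv ℝ n (f : E → V) x‖ ≤ M * ‖f‖ := by
  obtain ⟨M, hM0, hM⟩ := exists_norm_iteratedFDeriv_le_of_contDiff hH hk
  exact ⟨M, hM0, fun f => hM f (contDiff_coe hH hsymm hk f)⟩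

end Smoothness

/-! ### Riesz representers of derivative evaluations. -/

section Representers

/-- Expand `‖ψ s - ψ t‖²`: norm continuity of the representers follows from joint continuity of the
derivatives of `k`. -/
lemma continuous_of_continuous_inner {T H : Type*} [TopologicalSpace T] [NormedAddCommGroup H]
    [InnerProductSpace ℝ H] {ψ : T → H} (h : Continuous fun p : T × T => ⟪ψ p.1, ψ p.2⟫) :
    Continuous ψ := by
  rw [continuous_iff_continuousAt]
  intro t
  rw [ContinuousAt, tendsto_iff_norm_sub_tendsto_zero]
  have h1 : Tendsto (fun s => ‖ψ s - ψ t‖ ^ 2) (𝓝 t) (𝓝 0) := by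
    have e : ∀ s, ‖ψ s - ψ t‖ ^ 2 = ⟪ψ s, ψ s⟫ - 2 * ⟪ψ s, ψ t⟫ + ⟪ψ t, ψ t⟫ := fun s => by
      rw [norm_sub_sq_real]; simp only [real_inner_self_eq_norm_sq]
    have hc : Continuous fun s => ⟪ψ s, ψ s⟫ - 2 * ⟪ψ s, ψ t⟫ + ⟪ψ t, ψ t⟫ :=
      ((h.comp (continuous_id.prodMk continuous_id)).sub
        (continuous_const.mul (h.comp (continuous_id.prodMk continuous_const)))).add
        continuous_const
    simp only [e]
    have := hc.tendsto t
    convert this using 2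
    ring
  have h2 := (Real.continuous_sqrt.tendsto 0).comp h1
  simpa [Function.comp_def, Real.sqrt_sq (norm_nonneg _)] using h2

variable {E : Type*} [NormedAddCommGroup E] [InnerProductSpace ℝ E]
  {V : Type*} [NormedAddCommGroup V] [InnerProductSpace ℝ V] [CompleteSpace V]
  {H : Type*} [NormedAddCommGroup H] [InnerProductSpace ℝ H] [CompleteSpace H] [RKHS ℝ H E V]
  {k : E → E → ℝ}

/-- `ρ x u v` represents the functional `f ↦ ⟪v, Dⁿf(x)[u]⟫` on the space `H`. -/
def IsDerivRep {n : ℕ} (ρ : E → (Fin n → E) → V → H) : Prop :=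
  ∀ x u v (f : H), ⟪ρ x u v, f⟫ = ⟪v, iteratedFDeriv ℝ n (f : E → V) x u⟫

theorem exists_isDerivRep (hH : ∀ x y, RKHS.kernel H x y = k x y • ContinuousLinearMap.id ℝ V)
    (hsymm : ∀ x y, k x y = k y x) {n : ℕ} (hk : IsCb n k) :
    ∃ ρ : E → (Fin n → E) → V → H, IsDerivRep ρ ∧
      ∃ M : ℝ, 0 ≤ M ∧ ∀ x u v, ‖ρ x u v‖ ≤ M * (∏ i, ‖u i‖) * ‖v‖ := by
  obtain ⟨M, hM0, hM⟩ := exists_norm_iteratedFDeriv_le hH hsymm hk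
  have hsm : ∀ f : H, ContDiff ℝ n (f : E → V) := contDiff_coe hH hsymm hk
  have hbd : ∀ x (u : Fin n → E) (v : V) (f : H),
      ‖⟪v, iteratedFDeriv ℝ n (f : E → V) x u⟫‖ ≤ M * (∏ i, ‖u i‖) * ‖v‖ * ‖f‖ :=
    fun x u v f =>
    calc ‖⟪v, iteratedFDeriv ℝ n (f : E → V) x u⟫‖
        ≤ ‖v‖ * ‖iteratedFDeriv ℝ n (f : E → V) x u‖ := norm_inner_le_norm _ _
      _ ≤ ‖v‖ * ((M * ‖f‖) * ∏ i, ‖u i‖) := by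
          gcongr
          exact (ContinuousMultilinearMap.le_opNorm _ _).trans
            (mul_le_mul_of_nonneg_right (hM f x) (Finset.prod_nonneg fun _ _ => norm_nonneg _))
      _ = _ := by ring
  let L : E → (Fin n → E) → V → H →L[ℝ] ℝ := fun x u v =>
    LinearMap.mkContinuous
      { toFun := fun f => ⟪v, iteratedFDeriv ℝ n (f : E → V) x u⟫
        map_add' := fun f g => by
          rw [RKHS.coe_add, iteratedFDeriv_add_apply (hsm f).contDiffAt (hsm g).contDiffAt,
            add_apply, inner_add_right]
        map_smul' := fun c f => by
          rw [RKHS.coe_smul, iteratedFDeriv_const_smul_apply (hsm f).contDiffAt,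
            smul_apply, inner_smul_right]
          rfl }
      (M * (∏ i, ‖u i‖) * ‖v‖) (hbd x u v)
  refine ⟨fun x u v => (InnerProductSpace.toDual ℝ H).symm (L x u v), fun x u v f => ?_, M, hM0,
    fun x u v => ?_⟩
  · rw [InnerProductSpace.toDual_symm_apply]; rfl
  · rw [LinearIsometryEquiv.norm_map]
    exact LinearMap.mkContinuous_norm_le _ (by positivity) _

lemma IsDerivRep.coe_apply (hH : ∀ x y, RKHS.kernel H x y = k x y • ContinuousLinearMap.id ℝ V)
    (hsymm : ∀ x y, k x y = k y x) {n : ℕ} (hk : IsCb n k) {ρ : E → (Fin n → E) → V → H}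
    (hρ : IsDerivRep ρ) (x : E) (u : Fin n → E) (v : V) (y : E) :
    ρ x u v y = iteratedFDeriv ℝ n (fun z => k z y) x u • v := by
  refine ext_inner_right ℝ fun w => ?_
  have hs : ContDiff ℝ n (fun z => k z y) := by
    simpa only [hsymm _ y] using hk.contDiff_snd y
  rw [← RKHS.inner_kerFun, hρ]
  have : (RKHS.kerFun H y w : E → V) = fun z => k z y • w := funext fun z =>
    kerFun_apply_eq hH z y w
  rw [this, iteratedFDeriv_smul_const_apply hs.contDiffAt, inner_smul_left]
  simp [inner_smul_right]

/-- As a function, `ρ x u v` is `w ↦ D₁ᵐk(x, w)[u] • v`; pairing it with `σ` differentiates it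
again, now in the second variable. -/
lemma IsDerivRep.inner_eq_D21
    (hH : ∀ x y, RKHS.kernel H x y = k x y • ContinuousLinearMap.id ℝ V)
    (hsymm : ∀ x y, k x y = k y x) {m n α : ℕ} (hk : IsCb α k) (hm : m ≤ α) (hn : n ≤ α)
    {ρ : E → (Fin m → E) → V → H} (hρ : IsDerivRep ρ)
    {σ : E → (Fin n → E) → V → H} (hσ : IsDerivRep σ)
    (x : E) (u : Fin m → E) (v : V) (x' : E) (u' : Fin n → E) (v' : V) :
    ⟪ρ x u v, σ x' u' v'⟫ = ⟪v, v'⟫ * D21 n m k x x' u' u := by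
  have hs : ContDiff ℝ n (fun w => iteratedFDeriv ℝ m (fun z => k z w) x) :=
    (hk.contDiff_iteratedFDeriv_fst hsymm hm x).of_le (by exact_mod_cast hn)
  let L : ContinuousMultilinearMap ℝ (fun _ : Fin m => E) ℝ →L[ℝ] V :=
    (ContinuousMultilinearMap.apply ℝ (fun _ : Fin m => E) ℝ u).smulRight v
  have hfun : (ρ x u v : E → V) = L ∘ fun w => iteratedFDeriv ℝ m (fun z => k z w) x :=
    funext fun w => hρ.coe_apply hH hsymm (hk.mono hm) x u v w
  rw [real_inner_comm, hσ, hfun, L.iteratedFDeriv_comp_left hs.contDiffAt le_rfl]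
  simp [L, D21, inner_smul_right, real_inner_comm, mul_comm]

lemma D21_eq_D12_swap {m n : ℕ} (hsymm : ∀ x y, k x y = k y x) (x x' : E) :
    D21 m n k x' x = D12 m n k x x' := by
  simp only [D21, D12]
  congr 1
  funext z
  congr 1
  funext w
  exact hsymm w z

/-- Symmetry of the inner product and of `k` gives the other order of differentiation, with no
appeal to symmetry of mixed partials. This order serves the continuity clause of `IsCb` and the term
`D₁² D₂ k` of `h`. -/
lemma IsDerivRep.inner_eq_D12
    (hH : ∀ x y, RKHS.kernel H x y = k x y • ContinuousLinearMap.id ℝ V)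
    (hsymm : ∀ x y, k x y = k y x) {m n α : ℕ} (hk : IsCb α k) (hm : m ≤ α) (hn : n ≤ α)
    {ρ : E → (Fin m → E) → V → H} (hρ : IsDerivRep ρ)
    {σ : E → (Fin n → E) → V → H} (hσ : IsDerivRep σ)
    (x : E) (u : Fin m → E) (v : V) (x' : E) (u' : Fin n → E) (v' : V) :
    ⟪ρ x u v, σ x' u' v'⟫ = ⟪v, v'⟫ * D12 m n k x x' u u' := by
  rw [real_inner_comm, hσ.inner_eq_D21 hH hsymm hk hn hm hρ, D21_eq_D12_swap hsymm,
    real_inner_comm]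

lemma IsDerivRep.continuous
    (hH : ∀ x y, RKHS.kernel H x y = k x y • ContinuousLinearMap.id ℝ V)
    (hsymm : ∀ x y, k x y = k y x) {n : ℕ} (hk : IsCb n k)
    {ρ : E → (Fin n → E) → V → H} (hρ : IsDerivRep ρ) :
    Continuous fun p : E × (Fin n → E) × V => ρ p.1 p.2.1 p.2.2 := by
  refine continuous_of_continuous_inner ?_
  simp only [hρ.inner_eq_D12 hH hsymm hk le_rfl le_rfl hρ]
  have h1 := (hk.continuous n le_rfl n le_rfl).comp
    (continuous_fst.fst.prodMk continuous_snd.fst :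
      Continuous fun p : (E × (Fin n → E) × V) × (E × (Fin n → E) × V) => (p.1.1, p.2.1))
  refine Continuous.mul (by fun_prop) ?_
  exact (h1.eval continuous_fst.snd.fst).eval continuous_snd.snd.fst

end Representers

/-! ### The discrepancy as the norm of a Bochner mean. -/

section Discrepancy

variable {H : Type*} [NormedAddCommGroup H] [InnerProductSpace ℝ H]

lemma hasSum_inner_const_left {ι : Type*} {s : ι → H} {S : H} (hs : HasSum s S) (a : H) :
    HasSum (fun i => ⟪a, s i⟫) ⟪a, S⟫ := by
  simpa using hs.mapL (innerSL ℝ a)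

lemma hasSum_inner_prod {s t : ℕ → H} {S T : H} (hs : HasSum s S) (ht : HasSum t T)
    (hs' : Summable fun i => ‖s i‖) (ht' : Summable fun i => ‖t i‖) :
    HasSum (fun p : ℕ × ℕ => ⟪s p.1, t p.2⟫) ⟪S, T⟫ := by
  have hF : Summable (fun p : ℕ × ℕ => ⟪s p.1, t p.2⟫) :=
    Summable.of_norm_bounded (hs'.mul_of_nonneg ht' (fun _ => norm_nonneg _)
      fun _ => norm_nonneg _) fun p => norm_inner_le_norm _ _
  have h1 : HasSum (fun i => ⟪s i, T⟫) (∑' p : ℕ × ℕ, ⟪s p.1, t p.2⟫) :=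
    hF.hasSum.prod_fiberwise fun i => hasSum_inner_const_left ht (s i)
  have h2 : HasSum (fun i => ⟪s i, T⟫) ⟪S, T⟫ := by
    simpa only [real_inner_comm] using hasSum_inner_const_left hs T
  rw [← h1.unique h2]
  exact hF.hasSum

/-- A discrepancy over the unit ball of a Hilbert space, for an operator represented by an
integrable vector field, is the norm of the mean of that field. -/
theorem discrepancy_of_representer [CompleteSpace H] {X : Type*} [MeasurableSpace X]
    {Q : Measure X} [IsProbabilityMeasure Q] {ξ : X → H} (hξ : Integrable ξ Q)
    {op : H → X → ℝ} (hop : ∀ f x, op f x = ⟪ξ x, f⟫) :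
    (∀ f, Integrable (op f) Q) ∧
    BddAbove {r | ∃ f : H, ‖f‖ ≤ 1 ∧ r = |∫ x, op f x ∂Q|} ∧
    Integrable (fun z : X × X => ⟪ξ z.1, ξ z.2⟫) (Q.prod Q) ∧
    sSup {r | ∃ f : H, ‖f‖ ≤ 1 ∧ r = |∫ x, op f x ∂Q|} ^ 2 =
      ∫ z : X × X, ⟪ξ z.1, ξ z.2⟫ ∂(Q.prod Q) := by
  have hop' : ∀ f, op f = fun x => ⟪ξ x, f⟫ := fun f => funext (hop f)
  set g := ∫ x, ξ x ∂Q with hg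
  have hint : ∀ f, ∫ x, op f x ∂Q = ⟪g, f⟫ := fun f => by
    simp only [hop, real_inner_comm f]
    rw [integral_inner hξ f]
  have hgreat : IsGreatest {r | ∃ f : H, ‖f‖ ≤ 1 ∧ r = |∫ x, op f x ∂Q|} ‖g‖ := by
    -- The normalised mean attains the supremum; for `g = 0` the convention `0⁻¹ = 0` makes it the
    -- zero vector, with the correct value `0`.
    refine ⟨⟨‖g‖⁻¹ • g, ?_, ?_⟩, ?_⟩
    · rw [norm_smul, norm_inv, norm_norm]
      exact inv_mul_le_one
    · rw [hint, inner_smul_right, real_inner_self_eq_norm_sq]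
      by_cases h0 : ‖g‖ = 0
      · simp [h0]
      · rw [sq, ← mul_assoc, inv_mul_cancel₀ h0, one_mul, abs_norm]
    · rintro _ ⟨f, hf, rfl⟩
      rw [hint]
      exact (abs_real_inner_le_norm _ _).trans (mul_le_of_le_one_right (norm_nonneg _) hf)
  refine ⟨fun f => ?_, hgreat.bddAbove, ?_, ?_⟩
  · rw [hop']
    exact hξ.inner_const f
  · exact hξ.op_fst_snd (op := fun a b => ⟪a, b⟫) (by fun_prop)
      ⟨1, fun a b => by simpa using norm_inner_le_norm (𝕜 := ℝ) a b⟩ hξ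
  · rw [hgreat.csSup_eq, ← real_inner_self_eq_norm_sq]
    exact (integral_prod_bilin (innerSL ℝ) hξ hξ).symm

end Discrepancy

/-! ### Eigenvalues of the covariance and integrability of the drift. -/

section Gibbs

variable {E : Type*} [NormedAddCommGroup E] [InnerProductSpace ℝ E]

lemma inner_apply_eigenvector {C : E →L[ℝ] E} (hC : C.IsPositive) {v : E} {c : ℝ}
    (hv : C v = c • v) (w : E) : ⟪v, C w⟫ = c * ⟪v, w⟫ := by
  have h : ⟪C v, w⟫ = ⟪v, C w⟫ := hC.isSymmetric v w
  rw [← h, hv, real_inner_smul_left]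

variable [CompleteSpace E]

/-- The eigenvalues are the diagonal terms of the trace series, and unconditional summability in `ℝ`
is absolute. -/
lemma IsTraceClass.summable_eigenvalues {C : E →L[ℝ] E} (hC : IsTraceClass C)
    {ι : Type*} (e : HilbertBasis ι ℝ E) {lam : ι → ℝ} (heig : ∀ i, C (e i) = lam i • e i) :
    Summable fun i => |lam i| := by
  have h := (hC.hasSum_trace e).summable
  simpa [heig, inner_smul_right, real_inner_self_eq_norm_sq, e.orthonormal.1] using h.abs

lemma IsTraceClass.hasSum_trace_comp {C : E →L[ℝ] E} (hpos : C.IsPositive) (hC : IsTraceClass C)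
    {ι : Type*} (e : HilbertBasis ι ℝ E) {lam : ι → ℝ} (heig : ∀ i, C (e i) = lam i • e i)
    (A : E →L[ℝ] E) : HasSum (fun i => lam i * ⟪e i, A (e i)⟫) (trace (C ∘L A)) := by
  simpa [inner_apply_eigenvector hpos (heig _)] using (hC.comp_right A).hasSum_trace e

variable [MeasurableSpace E] [BorelSpace E]

lemma measurable_gradient (U : E → ℝ) : Measurable (gradient U) :=
  (InnerProductSpace.toDual ℝ E).symm.continuous.measurable.comp (measurable_fderiv ℝ U)

variable [TopologicalSpace.SeparableSpace E]

lemma measurable_drift (C : E →L[ℝ] E) (U : E → ℝ) : Measurable (drift C U) := by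
  have : SecondCountableTopology E := UniformSpace.secondCountable_of_separable E
  exact measurable_id.add (C.continuous.measurable.comp (measurable_gradient U))

variable {C R : E →L[ℝ] E} {U : E → ℝ} {γ P Q : Measure E}

lemma GibbsAssumption.integrable_norm_drift (hPQ : GibbsAssumption C R U γ P Q) :
    Integrable (fun x => ‖drift C U x‖) Q := by
  have : SecondCountableTopology E := UniformSpace.secondCountable_of_separable E
  have := hPQ.isProb_Q
  have h1 : Integrable (fun x : E => 1 + ‖x‖ ^ 2 + ‖C (gradient U x)‖) Q :=
    ((integrable_const _).add hPQ.integrable_sq_norm).add hPQ.integrable_drift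
  refine h1.mono' (measurable_drift C U).norm.aestronglyMeasurable (Eventually.of_forall fun x => ?_)
  rw [norm_norm]
  refine (norm_add_le _ _).trans ?_
  have : ‖x‖ ≤ 1 + ‖x‖ ^ 2 := by nlinarith [sq_nonneg (‖x‖ - 1), norm_nonneg x]
  linarith

end Gibbs

/-! ### Bochner integrability of the representing field. -/

section SteinRepresenter

variable {E : Type*} [NormedAddCommGroup E] [InnerProductSpace ℝ E] [CompleteSpace E]
  [TopologicalSpace.SeparableSpace E] [MeasurableSpace E] [BorelSpace E]
  {H : Type*} [NormedAddCommGroup H] [InnerProductSpace ℝ H] [CompleteSpace H]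
  {C R : E →L[ℝ] E} {U : E → ℝ} {γ P Q : Measure E}

/-- Integrability of a field that is affine in the drift. -/
lemma GibbsAssumption.integrable_field (hPQ : GibbsAssumption C R U γ P Q)
    {lam : ℕ → ℝ} (hlam : Summable fun i => |lam i|) {s : ℕ → E → H}
    (hs : ∀ i, Continuous (s i)) {M : ℝ} (hM : ∀ i x, ‖s i x‖ ≤ M) {r : E → E → H}
    (hr : Continuous fun p : E × E => r p.1 p.2) {N : ℝ} (hN : ∀ x v, ‖r x v‖ ≤ N * ‖v‖) :
    Integrable (fun x => ∑' i, lam i • s i x - r x (drift C U x)) Q := by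
  have : SecondCountableTopology E := UniformSpace.secondCountable_of_separable E
  have := hPQ.isProb_Q
  have hb : ∀ i x, ‖lam i • s i x‖ ≤ |lam i| * M := fun i x => by
    rw [norm_smul, Real.norm_eq_abs]
    gcongr
    exact hM i x
  have hc : Continuous fun x => ∑' i, lam i • s i x :=
    continuous_tsum (fun i => (hs i).const_smul _) (hlam.mul_right M) hb
  refine Integrable.sub ?_ ?_
  · exact Integrable.of_bound hc.aestronglyMeasurable (∑' i, |lam i| * M)
      (Eventually.of_forall fun x => tsum_of_norm_bounded (hlam.mul_right M).hasSum
        fun i => hb i x)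
  · refine (hPQ.integrable_norm_drift.const_mul N).mono' ?_ (Eventually.of_forall fun x => hN x _)
    exact (hr.stronglyMeasurable.comp_measurable
      (measurable_id.prodMk (measurable_drift C U))).aestronglyMeasurable

end SteinRepresenter

/-! ### The scalar Stein operator. -/

section Scalar

variable {E : Type*} [NormedAddCommGroup E] [InnerProductSpace ℝ E] [CompleteSpace E]

lemma differentiable_gradient {f : E → ℝ} (hf : ContDiff ℝ 2 f) :
    Differentiable ℝ (gradient f) :=
  (InnerProductSpace.toDual ℝ E).symm.toContinuousLinearEquiv.differentiable.comp
    ((hf.fderiv_right (m := 1) (by norm_num)).differentiable (by norm_num))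

lemma inner_fderiv_gradient {f : E → ℝ} (hf : ContDiff ℝ 2 f) (x u v : E) :
    ⟪v, fderiv ℝ (gradient f) x u⟫ = iteratedFDeriv ℝ 2 f x ![u, v] := by
  have hd := ((hf.fderiv_right (m := 1) (by norm_num)).differentiable (by norm_num)) x
  have h1 : HasFDerivAt (fun y => ⟪v, gradient f y⟫)
      ((innerSL ℝ v) ∘L fderiv ℝ (gradient f) x) x :=
    (innerSL ℝ v).hasFDerivAt.comp x (differentiable_gradient hf x).hasFDerivAt
  have h2 : HasFDerivAt (fun y => fderiv ℝ f y v)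
      ((ContinuousLinearMap.apply ℝ ℝ v) ∘L fderiv ℝ (fderiv ℝ f) x) x :=
    (ContinuousLinearMap.apply ℝ ℝ v).hasFDerivAt.comp x hd.hasFDerivAt
  simp only [real_inner_comm _ v, inner_gradient_left] at h1
  rw [iteratedFDeriv_two_apply]
  simpa using congrArg (fun L : E →L[ℝ] ℝ => L u) (h1.unique h2)

variable [TopologicalSpace.SeparableSpace E] [MeasurableSpace E] [BorelSpace E]
  {C R : E →L[ℝ] E} {U : E → ℝ} {γ P Q : Measure E}

theorem scalar_ksd (hPQ : GibbsAssumption C R U γ P Q)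
    (e : HilbertBasis ℕ ℝ E) (lam : ℕ → ℝ) (heig : ∀ i, C (e i) = lam i • e i)
    {k : E → E → ℝ} (hsymm : ∀ x y, k x y = k y x) (hk : IsCb 2 k)
    {H : Type*} [NormedAddCommGroup H] [InnerProductSpace ℝ H] [CompleteSpace H] [RKHS ℝ H E ℝ]
    (hH : ∀ x y, RKHS.kernel H x y = k x y • ContinuousLinearMap.id ℝ ℝ) :
    (∀ f : H, Differentiable ℝ (f : E → ℝ) ∧ Differentiable ℝ (gradient (f : E → ℝ)) ∧
      (∀ x, IsTraceClass (C ∘L fderiv ℝ (gradient (f : E → ℝ)) x)) ∧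
      Integrable (steinOp C U f) Q) ∧
    BddAbove (ksdValues H C U Q) ∧
    (∀ x x', Summable (term22 e lam k x x') ∧ Summable (term21 C U e lam k x x') ∧
      Summable (term12 C U e lam k x x')) ∧
    Integrable (fun z : E × E => h C U e lam k z.1 z.2) (Q.prod Q) ∧
    ksd H C U Q ^ 2 = ∫ z : E × E, h C U e lam k z.1 z.2 ∂(Q.prod Q) := by
  have := hPQ.isProb_Q
  have hlam := hPQ.traceClass.summable_eigenvalues e heig
  have hsm : ∀ f : H, ContDiff ℝ 2 (f : E → ℝ) := contDiff_coe hH hsymm hk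
  have hk1 : IsCb 1 k := hk.mono one_le_two
  obtain ⟨ρ, hρ, M, hM0, hM⟩ := exists_isDerivRep hH hsymm hk
  obtain ⟨σ, hσ, N, -, hN⟩ := exists_isDerivRep hH hsymm hk1
  -- Here `V = ℝ`, so the test vector is `1`; the two fields represent `D²f(x)[eᵢ, eᵢ]` and
  -- `Df(x)[v]`.
  set s : ℕ → E → H := fun i x => ρ x ![e i, e i] 1 with hs
  set r : E → E → H := fun x v => σ x ![v] 1 with hr
  have hsM : ∀ i x, ‖s i x‖ ≤ M := fun i x => by
    simpa [Fin.prod_univ_two, e.orthonormal.1] using hM x ![e i, e i] 1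
  have hrN : ∀ x v, ‖r x v‖ ≤ N * ‖v‖ := fun x v => by simpa using hN x ![v] 1
  have hsc : ∀ i, Continuous (s i) := fun i =>
    (hρ.continuous hH hsymm hk).comp
      (continuous_id.prodMk (continuous_const (y := (![e i, e i], (1 : ℝ)))))
  have hvec : Continuous fun p : E × E => ![p.2] := continuous_pi fun i => by
    rw [Subsingleton.elim i 0]
    exact continuous_snd
  have hrc : Continuous fun p : E × E => r p.1 p.2 :=
    (hσ.continuous hH hsymm hk1).comp
      (continuous_fst.prodMk (hvec.prodMk (continuous_const (y := (1 : ℝ)))))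
  have hsn : ∀ x, Summable fun i => ‖lam i • s i x‖ := fun x =>
    Summable.of_nonneg_of_le (fun _ => norm_nonneg _)
      (fun i => by
        rw [norm_smul, Real.norm_eq_abs]
        exact mul_le_mul_of_nonneg_left (hsM i x) (abs_nonneg _)) (hlam.mul_right M)
  have hS : ∀ x, HasSum (fun i => lam i • s i x) (∑' i, lam i • s i x) := fun x =>
    (hsn x).of_norm.hasSum
  have hop : ∀ (f : H) x, steinOp C U f x =
      ⟪∑' i, lam i • s i x - r x (drift C U x), f⟫ := fun f x => by
    rw [steinOp, inner_sub_left]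
    congr 1
    · have h1 := hPQ.traceClass.hasSum_trace_comp hPQ.pos e heig (fderiv ℝ (gradient f) x)
      have h2 := hasSum_inner_const_left (hS x) f
      refine h1.unique ?_
      rw [real_inner_comm]
      convert h2 using 2 with i
      rw [inner_fderiv_gradient (hsm f), inner_smul_right, real_inner_comm,
        hs, hρ]
      simp
    · rw [hr, hσ, inner_gradient_left, iteratedFDeriv_one_apply]
      simp
  have h22 : ∀ x x', HasSum (term22 e lam k x x')
      ⟪∑' i, lam i • s i x, ∑' i, lam i • s i x'⟫ := fun x x' => by
    convert hasSum_inner_prod (hS x) (hS x') (hsn x) (hsn x') using 2 with p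
    rw [inner_smul_left, inner_smul_right, hs, hρ.inner_eq_D21 hH hsymm hk le_rfl le_rfl hρ, term22]
    simp [mul_assoc]
  have h21 : ∀ x x', HasSum (term21 C U e lam k x x')
      ⟪r x (drift C U x), ∑' i, lam i • s i x'⟫ := fun x x' => by
    convert hasSum_inner_const_left (hS x') (r x (drift C U x)) using 2 with i
    rw [inner_smul_right, hs, hr,
      hσ.inner_eq_D21 hH hsymm hk one_le_two le_rfl hρ, term21]
    simp
  have h12 : ∀ x x', HasSum (term12 C U e lam k x x')
      ⟪∑' i, lam i • s i x, r x' (drift C U x')⟫ := fun x x' => by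
    rw [real_inner_comm]
    convert hasSum_inner_const_left (hS x) (r x' (drift C U x')) using 2 with i
    rw [inner_smul_right, real_inner_comm, hs, hr,
      hρ.inner_eq_D12 hH hsymm hk le_rfl one_le_two hσ, term12]
    simp
  -- The four terms of `h` are the four products in the expansion of `⟪ξ x, ξ x'⟫`.
  have hh : ∀ x x', h C U e lam k x x' = ⟪∑' i, lam i • s i x - r x (drift C U x),
      ∑' i, lam i • s i x' - r x' (drift C U x')⟫ := fun x x' => by
    have h11 : ⟪r x (drift C U x), r x' (drift C U x')⟫ =
        D21 1 1 k x x' ![drift C U x'] ![drift C U x] := by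
      rw [hr, hσ.inner_eq_D21 hH hsymm hk1 le_rfl le_rfl hσ]
      simp
    rw [h, (h22 x x').tsum_eq, (h21 x x').tsum_eq, (h12 x x').tsum_eq, ← h11, inner_sub_left,
      inner_sub_right, inner_sub_right]
    ring
  obtain ⟨hi, hb, hp, heq⟩ := discrepancy_of_representer
    (hPQ.integrable_field hlam hsc hsM hrc hrN) (op := fun f => steinOp C U (f : E → ℝ)) hop
  simp only [hh]
  exact ⟨fun f => ⟨(hsm f).differentiable two_ne_zero, differentiable_gradient (hsm f),
    fun x => hPQ.traceClass.comp_right _, hi f⟩, hb,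
    fun x x' => ⟨(h22 x x').summable, (h21 x x').summable, (h12 x x').summable⟩, hp, heq⟩

end Scalar

/-! ### The vectorised Stein operator. -/

section Vector

variable {E : Type*} [NormedAddCommGroup E] [InnerProductSpace ℝ E] [CompleteSpace E]

lemma inner_grad1 (k : E → E → ℝ) (x y v : E) :
    ⟪v, grad1 k x y⟫ = iteratedFDeriv ℝ 1 (fun z => k z y) x ![v] := by
  rw [grad1, real_inner_comm, inner_gradient_left, iteratedFDeriv_one_apply]
  simp

lemma grad2_eq_grad1 {k : E → E → ℝ} (hsymm : ∀ x y, k x y = k y x) (x y : E) :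
    grad2 k x y = grad1 k y x := by
  simp only [grad1, grad2, hsymm x]

lemma inner_grad21 {k : E → E → ℝ} (hsymm : ∀ x y, k x y = k y x) (hk : IsCb 1 k)
    (x y u v : E) : ⟪v, grad21 k x y u⟫ = D21 1 1 k x y ![u] ![v] := by
  have hd := (hk.contDiff_iteratedFDeriv_fst hsymm le_rfl x).differentiable (by simp)
  have hg : Differentiable ℝ (fun w => grad1 k x w) := by
    have : (fun w => grad1 k x w) = fun w => (InnerProductSpace.toDual ℝ E).symm
        (continuousMultilinearCurryFin1 ℝ E ℝ (iteratedFDeriv ℝ 1 (fun z => k z w) x)) := by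
      funext w
      refine ext_inner_left ℝ fun v => ?_
      rw [inner_grad1, real_inner_comm, InnerProductSpace.toDual_symm_apply]
      simp
    rw [this]
    exact (InnerProductSpace.toDual ℝ E).symm.toContinuousLinearEquiv.differentiable.comp
      ((continuousMultilinearCurryFin1 ℝ E ℝ).toContinuousLinearEquiv.differentiable.comp hd)
  have h1 : HasFDerivAt (fun w => ⟪v, grad1 k x w⟫) ((innerSL ℝ v) ∘L grad21 k x y) y :=
    (innerSL ℝ v).hasFDerivAt.comp y (hg y).hasFDerivAt
  have h2 : HasFDerivAt (fun w => iteratedFDeriv ℝ 1 (fun z => k z w) x ![v])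
      ((ContinuousMultilinearMap.apply ℝ (fun _ : Fin 1 => E) ℝ ![v]) ∘L
        fderiv ℝ (fun w => iteratedFDeriv ℝ 1 (fun z => k z w) x) y) y :=
    (ContinuousMultilinearMap.apply ℝ (fun _ : Fin 1 => E) ℝ ![v]).hasFDerivAt.comp y
      (hd y).hasFDerivAt
  simp only [inner_grad1] at h1
  have := congrArg (fun L : E →L[ℝ] ℝ => L u) (h1.unique h2)
  rw [D21, iteratedFDeriv_one_apply]
  simpa using this

variable [TopologicalSpace.SeparableSpace E] [MeasurableSpace E] [BorelSpace E]
  {C R : E →L[ℝ] E} {U : E → ℝ} {γ P Q : Measure E}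

theorem vector_ksd (hPQ : GibbsAssumption C R U γ P Q)
    (e : HilbertBasis ℕ ℝ E) (lam : ℕ → ℝ) (heig : ∀ i, C (e i) = lam i • e i)
    {k : E → E → ℝ} (hsymm : ∀ x y, k x y = k y x) (hk : IsCb 1 k)
    {H : Type*} [NormedAddCommGroup H] [InnerProductSpace ℝ H] [CompleteSpace H] [RKHS ℝ H E E]
    (hH : ∀ x y, RKHS.kernel H x y = k x y • ContinuousLinearMap.id ℝ E) :
    (∀ F : H, Differentiable ℝ (F : E → E) ∧
      (∀ x, IsTraceClass (C ∘L fderiv ℝ (F : E → E) x)) ∧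
      Integrable (steinOpVec C U F) Q) ∧
    BddAbove (ksdVecValues H C U Q) ∧
    (∀ x x', IsTraceClass (C ∘L C ∘L grad21 k x x')) ∧
    Integrable (fun z : E × E => hv C U k z.1 z.2) (Q.prod Q) ∧
    ksdVec H C U Q ^ 2 = ∫ z : E × E, hv C U k z.1 z.2 ∂(Q.prod Q) := by
  have := hPQ.isProb_Q
  have hlam := hPQ.traceClass.summable_eigenvalues e heig
  have hsm : ∀ f : H, ContDiff ℝ 1 (f : E → E) := contDiff_coe hH hsymm hk
  obtain ⟨ρ, hρ, M, hM0, hM⟩ := exists_isDerivRep hH hsymm hk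
  have hk0 : IsCb 0 k := hk.mono zero_le_one
  obtain ⟨σ, hσ, N, -, hN⟩ := exists_isDerivRep hH hsymm hk0
  -- Divergence terms `⟪eᵢ, DF(x) eᵢ⟫` come from order one, point evaluations `⟪v, F x⟫` from order
  -- zero, with the empty tuple of directions.
  set s : ℕ → E → H := fun i x => ρ x ![e i] (e i) with hs
  set r : E → E → H := fun x v => σ x ![] v with hr
  have hrf : ∀ x v (f : H), ⟪r x v, f⟫ = ⟪v, f x⟫ := fun x v f => by simp [hr, hσ x ![] v f]
  have hsM : ∀ i x, ‖s i x‖ ≤ M := fun i x => by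
    simpa [e.orthonormal.1] using hM x ![e i] (e i)
  have hrN : ∀ x v, ‖r x v‖ ≤ N * ‖v‖ := fun x v => by simpa using hN x ![] v
  have hsc : ∀ i, Continuous (s i) := fun i =>
    (hρ.continuous hH hsymm hk).comp
      (continuous_id.prodMk (continuous_const (y := (![e i], e i))))
  have hrc : Continuous fun p : E × E => r p.1 p.2 :=
    (hσ.continuous hH hsymm hk0).comp
      (continuous_fst.prodMk ((continuous_const (y := ![])).prodMk continuous_snd))
  have hsn : ∀ x, Summable fun i => ‖lam i • s i x‖ := fun x =>
    Summable.of_nonneg_of_le (fun _ => norm_nonneg _)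
      (fun i => by
        rw [norm_smul, Real.norm_eq_abs]
        exact mul_le_mul_of_nonneg_left (hsM i x) (abs_nonneg _)) (hlam.mul_right M)
  have hS : ∀ x, HasSum (fun i => lam i • s i x) (∑' i, lam i • s i x) := fun x =>
    (hsn x).of_norm.hasSum
  have hop : ∀ (f : H) x, steinOpVec C U f x =
      ⟪∑' i, lam i • s i x - r x (drift C U x), f⟫ := fun f x => by
    rw [steinOpVec, inner_sub_left]
    congr 1
    · have h1 := hPQ.traceClass.hasSum_trace_comp hPQ.pos e heig (fderiv ℝ f x)
      have h2 := hasSum_inner_const_left (hS x) f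
      refine h1.unique ?_
      rw [real_inner_comm]
      convert h2 using 2 with i
      rw [inner_smul_right, real_inner_comm (s i x), hs, hρ,
        iteratedFDeriv_one_apply]
      simp
    · rw [hrf, real_inner_comm]
  have hSS : ∀ x x', ⟪∑' i, lam i • s i x, ∑' i, lam i • s i x'⟫ =
      trace (C ∘L C ∘L grad21 k x x') := fun x x' => by
    have h1 := hasSum_inner_prod (hS x) (hS x') (hsn x) (hsn x')
    -- The factor `⟪eᵢ, eⱼ⟫` from `k • id` kills the off-diagonal terms; the surviving `λᵢ²` yields
    -- the trace with `C²`.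
    have hterm : ∀ i j, ⟪lam i • s i x, lam j • s j x'⟫ =
        if j = i then lam i * (lam i * ⟪e i, grad21 k x x' (e i)⟫) else 0 := fun i j => by
      rw [inner_smul_left, inner_smul_right, hs, hρ.inner_eq_D21 hH hsymm hk le_rfl le_rfl hρ,
        orthonormal_iff_ite.mp e.orthonormal, inner_grad21 hsymm hk]
      split_ifs with h1 h2 h2
      · subst h1; simp
      · exact absurd h1.symm h2
      · exact absurd h2.symm h1
      · simp
    simp only [hterm] at h1
    have h2 := h1.prod_fiberwise fun i => hasSum_ite_eq i
      (lam i * (lam i * ⟪e i, grad21 k x x' (e i)⟫))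
    refine h2.unique ?_
    convert hPQ.traceClass.hasSum_trace_comp hPQ.pos e heig (C ∘L grad21 k x x') using 3 with i
    exact (inner_apply_eigenvector hPQ.pos (heig i) _).symm
  have hSr : ∀ x x' v, ⟪∑' i, lam i • s i x, r x' v⟫ = ⟪grad1 k x x', C v⟫ := fun x x' v => by
    have h1 := hasSum_inner_const_left (hS x) (r x' v)
    rw [real_inner_comm]
    refine h1.unique ?_
    -- The series is `∑ λᵢ D₁k(x, x')[eᵢ] ⟪v, eᵢ⟫`; absorbing `λᵢ` into `C v` makes it Parseval's
    -- identity.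
    have h2 : HasSum (fun i => ⟪grad1 k x x', e i⟫ * ⟪e i, C v⟫) ⟪grad1 k x x', C v⟫ :=
      e.hasSum_inner_mul_inner _ _
    convert h2 using 2 with i
    rw [inner_smul_right, hrf, hs,
      hρ.coe_apply hH hsymm hk, inner_smul_right, inner_apply_eigenvector hPQ.pos (heig i),
      real_inner_comm (e i) (grad1 k x x'), inner_grad1, real_inner_comm v]
    ring
  have hrr : ∀ x x' v v', ⟪r x v, r x' v'⟫ = k x x' * ⟪v, v'⟫ := fun x x' v v' => by
    rw [hr, hσ.inner_eq_D21 hH hsymm hk0 le_rfl le_rfl hσ]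
    simp [D21, mul_comm]
  have hdr : ∀ x, C x + C (C (gradient U x)) = C (drift C U x) := fun x => by
    rw [drift, map_add]
  have hh : ∀ x x', hv C U k x x' = ⟪∑' i, lam i • s i x - r x (drift C U x),
      ∑' i, lam i • s i x' - r x' (drift C U x')⟫ := fun x x' => by
    rw [hv, inner_sub_left, inner_sub_right, inner_sub_right, hSS, hSr,
      real_inner_comm _ (r x (drift C U x)), hSr, hrr, hdr, hdr,
      grad2_eq_grad1 hsymm]
    ring
  obtain ⟨hi, hb, hp, heq⟩ := discrepancy_of_representer
    (hPQ.integrable_field hlam hsc hsM hrc hrN) (op := fun f => steinOpVec C U (f : E → E)) hop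
  simp only [hh]
  exact ⟨fun f => ⟨(hsm f).differentiable one_ne_zero,
    fun x => hPQ.traceClass.comp_right _, hi f⟩, hb,
    fun x x' => hPQ.traceClass.comp_right _, hp, heq⟩

end Vector

end SteinKernel

theorem corollary1 {E : Type*} [NormedAddCommGroup E] [InnerProductSpace ℝ E] [CompleteSpace E]
    [TopologicalSpace.SeparableSpace E] [MeasurableSpace E] [BorelSpace E]
    (hdim : ¬ FiniteDimensional ℝ E)
    (C R : E →L[ℝ] E) (U : E → ℝ) (γ P Q : Measure E)
    (hPQ : SteinKernel.GibbsAssumption C R U γ P Q)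
    (e : HilbertBasis ℕ ℝ E) (lam : ℕ → ℝ) (heig : ∀ i, C (e i) = lam i • e i)
    (k : E → E → ℝ) (hk : SteinKernel.IsKernel k) :
    (SteinKernel.IsCb 2 k →
      ∀ (H : Type*) [NormedAddCommGroup H] [InnerProductSpace ℝ H] [CompleteSpace H]
        [RKHS ℝ H E ℝ],
        (∀ x y, RKHS.kernel H x y = k x y • ContinuousLinearMap.id ℝ ℝ) →
        (∀ f : H, Differentiable ℝ (f : E → ℝ) ∧ Differentiable ℝ (gradient (f : E → ℝ)) ∧
          (∀ x, SteinKernel.IsTraceClass (C ∘L fderiv ℝ (gradient (f : E → ℝ)) x)) ∧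
          Integrable (SteinKernel.steinOp C U f) Q) ∧
        BddAbove (SteinKernel.ksdValues H C U Q) ∧
        (∀ x x', Summable (SteinKernel.term22 e lam k x x') ∧
          Summable (SteinKernel.term21 C U e lam k x x') ∧
          Summable (SteinKernel.term12 C U e lam k x x')) ∧
        Integrable (fun z : E × E => SteinKernel.h C U e lam k z.1 z.2) (Q.prod Q) ∧
        SteinKernel.ksd H C U Q ^ 2 =
          ∫ z : E × E, SteinKernel.h C U e lam k z.1 z.2 ∂(Q.prod Q)) ∧
    (SteinKernel.IsCb 1 k →
      ∀ (H : Type*) [NormedAddCommGroup H] [InnerProductSpace ℝ H] [CompleteSpace H]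
        [RKHS ℝ H E E],
        (∀ x y, RKHS.kernel H x y = k x y • ContinuousLinearMap.id ℝ E) →
        (∀ F : H, Differentiable ℝ (F : E → E) ∧
          (∀ x, SteinKernel.IsTraceClass (C ∘L fderiv ℝ (F : E → E) x)) ∧
          Integrable (SteinKernel.steinOpVec C U F) Q) ∧
        BddAbove (SteinKernel.ksdVecValues H C U Q) ∧
        (∀ x x', SteinKernel.IsTraceClass (C ∘L C ∘L SteinKernel.grad21 k x x')) ∧
        Integrable (fun z : E × E => SteinKernel.hv C U k z.1 z.2) (Q.prod Q) ∧
        SteinKernel.ksdVec H C U Q ^ 2 =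
          ∫ z : E × E, SteinKernel.hv C U k z.1 z.2 ∂(Q.prod Q)) :=
  ⟨fun hk2 _ _ _ _ _ hH => SteinKernel.scalar_ksd hPQ e lam heig hk.1 hk2 hH,
    fun hk1 _ _ _ _ _ hH => SteinKernel.vector_ksd hPQ e lam heig hk.1 hk1 hH⟩
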